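/- For $\alpha\in\mathbb R$ let $\mathbb A_\alpha$ be the noncommutative $2$-torus, i.e. the universal unital $C^*$-algebra generated by two unitaries $U,V$ with $UV=e^{2\pi i\alpha}VU$. Let $\mathbb T$ be the unit circle with normalised Haar measure $\mathrm m$. For $\theta\in\mathbb R$ and a continuous $f:\mathbb T\to\mathbb T$ let $\Phi=\Phi_{\theta,f}$ be the $*$-automorphism of $\mathbb A_\alpha$ determined by $\Phi(U)=e^{i\theta}U$ and $\Phi(V)=f(U)V$. For $n\in\mathbb Z$ and $z\in\mathbb T$ put $$f_n(z)=\prod_{l=0}^{n-1}f(e^{-2\pi i l\alpha}z)\ (n>0),\qquad f_0(z)=1,\qquad f_n(z)=\prod_{l=1}^{|n|}\overline{f(e^{2\pi i l\alpha}z)}\ (n<0).$$ Suppose that $\theta/2\pi$ is irrational and that for some $n\in\mathbb Z\smallsetminus\{0\}$ the cohomological equation $$g(e^{i\theta}z)\,f_n(z)=g(z)\qquad\text{for }\mathrm m\text{-a.e. }z\in\mathbb T$$ has a solution $g\in L^2(\mathbb T,\mathrm m)\smallsetminus C(\mathbb T)$, that is, a solution that is not $\mathrm m$-a.e. equal to a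 continuous function. Then: (1) there is $a\in\mathbb A_\alpha$ such that the Cesàro means $\frac1N\sum_{k=0}^{N-1}\Phi^k(a)$ have no limit in $\mathbb A_\alpha$, as $N\to\infty$, in the weak topology $\sigma(\mathbb A_\alpha,\mathbb A_\alpha^*)$; (2) consequently the $C^*$-dynamical system $(\mathbb A_\alpha,\Phi)$ is not uniquely ergodic with respect to its fixed-point subalgebra $\mathbb A_\alpha^\Phi=\{x:\Phi(x)=x\}$: it is not the case that $\frac1N\sum_{k=0}^{N-1}\Phi^k(a)$ converges in norm for every $a\in\mathbb A_\alpha$, and it is not the case that every state of $\mathbb A_\alpha^\Phi$ has exactly one $\Phi$-invariant extension to a state of $\mathbb A_\alpha$. -/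

import Mathlib

open scoped ENNReal
open MeasureTheory

universe u

noncomputable section

namespace NCAnzai

open scoped CStarAlgebra

/-! ### The unit circle and its normalised Haar measure -/

/-- The Borel `σ`-algebra of the unit circle. -/
instance circleMeasurableSpace : MeasurableSpace Circle := borel Circle

instance circleBorelSpace : BorelSpace Circle := ⟨rfl⟩

/-- The normalised Haar (Lebesgue) measure of the unit circle. -/
def circleHaar : Measure Circle := Measure.haarMeasure ⊤

/-- A function on the circle, extended by zero to the plane, so that it can be fed to the
continuous functional calculus of a unitary element. -/
def circleExt (f : C(Circle, Circle)) (z : ℂ) : ℂ :=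
  open Classical in
  if h : z ∈ Submonoid.unitSphere ℂ then ((f ⟨z, h⟩ : Circle) : ℂ) else 0

/-- `f(w)` for a unitary `w` of a unital C*-algebra and a continuous `f : 𝕋 → 𝕋`. -/
def circleFun {B : Type*} [CStarAlgebra B] (f : C(Circle, Circle)) (w : B) : B :=
  cfc (circleExt f) w

lemma circleExt_coe (f : C(Circle, Circle)) (z : Circle) : circleExt f (z : ℂ) = f z := by
  have h : (z : ℂ) ∈ Submonoid.unitSphere ℂ := z.2
  simp only [circleExt, dif_pos h]
  rfl

lemma continuousOn_circleExt (f : C(Circle, Circle)) :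
    ContinuousOn (circleExt f) (Metric.sphere (0 : ℂ) 1) := by
  rw [continuousOn_iff_continuous_domRestrict]
  have : Set.domRestrict (Metric.sphere (0 : ℂ) 1) (circleExt f) =
      fun z => ((f (⟨z.1, z.2⟩ : Circle) : Circle) : ℂ) := by
    funext z
    exact circleExt_coe f ⟨z.1, z.2⟩
  rw [this]
  exact continuous_subtype_val.comp (f.continuous.comp continuous_id)

lemma spectrum_subset_circle {B : Type*} [CStarAlgebra B] {w : B} (hw : w ∈ unitary B) :
    spectrum ℂ w ⊆ Metric.sphere (0 : ℂ) 1 :=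
  spectrum.subset_circle_of_unitary hw

lemma continuousOn_circleExt_spectrum {B : Type*} [CStarAlgebra B] {w : B} (hw : w ∈ unitary B)
    (f : C(Circle, Circle)) : ContinuousOn (circleExt f) (spectrum ℂ w) :=
  (continuousOn_circleExt f).mono (spectrum_subset_circle hw)

lemma isStarNormal_of_unitary {B : Type*} [CStarAlgebra B] {w : B} (hw : w ∈ unitary B) :
    IsStarNormal w :=
  ⟨by rw [Commute, SemiconjBy, (Unitary.mem_iff.1 hw).1, (Unitary.mem_iff.1 hw).2]⟩

lemma circleFun_mem_unitary {B : Type*} [CStarAlgebra B] {w : B} (hw : w ∈ unitary B)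
    (f : C(Circle, Circle)) : circleFun f w ∈ unitary B := by
  have hn := isStarNormal_of_unitary hw
  refine (cfc_unitary_iff (circleExt f) w hn (continuousOn_circleExt_spectrum hw f)).2 ?_
  intro x hx
  obtain ⟨z, rfl⟩ : ∃ z : Circle, (z : ℂ) = x := ⟨⟨x, spectrum_subset_circle hw hx⟩, rfl⟩
  rw [circleExt_coe]
  have := Circle.normSq_coe (f z)
  simp [← Complex.normSq_eq_conj_mul_self, this]

lemma circleFun_commute {B : Type*} [CStarAlgebra B] (w : B) (f : C(Circle, Circle)) :
    Commute w (circleFun f w) := by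
  have := cfc_commute_cfc id (circleExt f) w (R := ℂ)
  by_cases hn : IsStarNormal w
  · rwa [cfc_id ℂ w] at this
  · have : circleFun f w = 0 := cfc_apply_of_not_predicate w hn
    rw [this]
    exact Commute.zero_right w

lemma smul_mem_unitary {B : Type*} [CStarAlgebra B] {w : B} (hw : w ∈ unitary B) (c : Circle) :
    (c : ℂ) • w ∈ unitary B := by
  have h : (starRingEnd ℂ) (c : ℂ) * (c : ℂ) = 1 := by
    rw [← Complex.normSq_eq_conj_mul_self, Circle.normSq_coe]; simp
  rw [Unitary.mem_iff]
  simp only [star_smul, smul_mul_smul_comm, (Unitary.mem_iff.1 hw).1, (Unitary.mem_iff.1 hw).2,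
    RCLike.star_def]
  constructor
  · rw [h, one_smul]
  · rw [mul_comm, h, one_smul]

/-! ### The noncommutative 2-torus

`NCTorus α` is the universal unital C*-algebra generated by two unitaries `U`, `V` with
`U V = e^{2 π i α} V U`: the closed *-subalgebra generated by the universal pair inside the
`ℓ^∞`-product of all (nonzero, unital) C*-algebras with a distinguished pair of unitaries that
satisfies the relation. Equivalently, the norm of a noncommutative polynomial in `U`, `V` is the
supremum of its norms over all such pairs. -/

/-- A representation of the commutation relation of parameter `α`: a pair of unitaries
`u`, `v` with `u v = e^{2 π i α} v u` in a nonzero unital C*-algebra. -/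
structure Rep (α : ℝ) : Type (u + 1) where
  /-- the C*-algebra that contains the pair -/
  carrier : Type u
  [cstar : CStarAlgebra carrier]
  [nontriv : Nontrivial carrier]
  /-- the first unitary -/
  u : carrier
  /-- the second unitary -/
  v : carrier
  u_mem : u ∈ unitary carrier
  v_mem : v ∈ unitary carrier
  rel : u * v = (Circle.exp (2 * Real.pi * α) : ℂ) • (v * u)

attribute [instance] Rep.cstar Rep.nontriv

/-- The `ℓ^∞`-product of all representations of the relation. -/
abbrev RepProd (α : ℝ) : Type (u + 1) := lp (fun i : Rep.{u} α => i.carrier) ∞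

instance repProdCStarAlgebra (α : ℝ) : CStarAlgebra (RepProd.{u} α) where

lemma memℓp_unitary {α : ℝ} (x : ∀ i : Rep.{u} α, i.carrier) (hx : ∀ i, x i ∈ unitary i.carrier) :
    Memℓp x ∞ :=
  memℓp_infty ⟨1, by
    rintro _ ⟨i, rfl⟩
    exact (CStarRing.norm_of_mem_unitary (hx i)).le⟩

/-- The universal pair, first component. -/
def prodU (α : ℝ) : RepProd.{u} α := ⟨fun i => i.u, memℓp_unitary _ fun i => i.u_mem⟩

/-- The universal pair, second component. -/
def prodV (α : ℝ) : RepProd.{u} α := ⟨fun i => i.v, memℓp_unitary _ fun i => i.v_mem⟩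

/-- The closed *-subalgebra generated by the universal pair. -/
def ncTorus (α : ℝ) : StarSubalgebra ℂ (RepProd.{u} α) :=
  (StarAlgebra.adjoin ℂ {prodU α, prodV α}).topologicalClosure

/-- The noncommutative 2-torus `𝔸_α`. -/
abbrev NCTorus (α : ℝ) : Type (u + 1) := ncTorus.{u} α

instance ncTorus_isClosed (α : ℝ) : IsClosed (ncTorus.{u} α : Set (RepProd.{u} α)) :=
  StarSubalgebra.isClosed_topologicalClosure _

instance ncTorusCStarAlgebra (α : ℝ) : CStarAlgebra (NCTorus.{u} α) :=
  StarSubalgebra.cstarAlgebra (ncTorus.{u} α)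

lemma prodU_mem (α : ℝ) : prodU α ∈ ncTorus.{u} α :=
  StarSubalgebra.le_topologicalClosure _ (StarAlgebra.subset_adjoin ℂ _ (by simp))

lemma prodV_mem (α : ℝ) : prodV α ∈ ncTorus.{u} α :=
  StarSubalgebra.le_topologicalClosure _ (StarAlgebra.subset_adjoin ℂ _ (by simp))

/-- The canonical generator `U`. -/
def genU (α : ℝ) : NCTorus.{u} α := ⟨prodU α, prodU_mem α⟩

/-- The canonical generator `V`. -/
def genV (α : ℝ) : NCTorus.{u} α := ⟨prodV α, prodV_mem α⟩

/-- The coordinate projection of the product. -/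
def prodEval {α : ℝ} (i : Rep.{u} α) : RepProd.{u} α →⋆ₐ[ℂ] i.carrier where
  toFun x := x i
  map_one' := rfl
  map_mul' _ _ := rfl
  map_zero' := rfl
  map_add' _ _ := rfl
  commutes' _ := rfl
  map_star' _ := rfl

/-- The representation of `𝔸_α` given by a pair of unitaries that satisfies the relation. -/
def eval {α : ℝ} (i : Rep.{u} α) : NCTorus.{u} α →⋆ₐ[ℂ] i.carrier :=
  (prodEval i).comp (ncTorus.{u} α).subtype

lemma genU_mem_unitary (α : ℝ) : genU.{u} α ∈ unitary (NCTorus.{u} α) := by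
  constructor <;> refine Subtype.ext (lp.ext (funext fun i => ?_))
  · exact (Unitary.mem_iff.1 i.u_mem).1
  · exact (Unitary.mem_iff.1 i.u_mem).2

lemma genV_mem_unitary (α : ℝ) : genV.{u} α ∈ unitary (NCTorus.{u} α) := by
  constructor <;> refine Subtype.ext (lp.ext (funext fun i => ?_))
  · exact (Unitary.mem_iff.1 i.v_mem).1
  · exact (Unitary.mem_iff.1 i.v_mem).2

lemma genU_mul_genV (α : ℝ) :
    genU.{u} α * genV α = (Circle.exp (2 * Real.pi * α) : ℂ) • (genV.{u} α * genU α) :=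
  Subtype.ext (lp.ext (funext fun i => i.rel))

/-- *-homomorphisms on `𝔸_α` are determined by their values on `U` and `V`. -/
lemma hom_ext {α : ℝ} {B : Type*} [CStarAlgebra B] {φ ψ : NCTorus.{u} α →⋆ₐ[ℂ] B}
    (hU : φ (genU α) = ψ (genU α)) (hV : φ (genV α) = ψ (genV α)) : φ = ψ := by
  have hφ : Continuous φ := map_continuous φ
  have hψ : Continuous ψ := map_continuous ψ
  refine StarAlgHom.ext_topologicalClosure (S := StarAlgebra.adjoin ℂ {prodU α, prodV α}) hφ hψ ?_
  refine StarAlgHom.ext_adjoin ?_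
  rintro ⟨x, hx⟩ hx'
  rcases hx' with rfl | rfl
  · exact hU
  · exact hV

/-- The universal property of `𝔸_α`. -/
theorem existsUnique_hom {α : ℝ} {B : Type u} [CStarAlgebra B] [Nontrivial B] (x y : B)
    (hx : x ∈ unitary B) (hy : y ∈ unitary B)
    (h : x * y = (Circle.exp (2 * Real.pi * α) : ℂ) • (y * x)) :
    ∃! φ : NCTorus.{u} α →⋆ₐ[ℂ] B, φ (genU α) = x ∧ φ (genV α) = y :=
  ⟨eval ⟨B, x, y, hx, hy, h⟩, ⟨rfl, rfl⟩, fun _ hψ => hom_ext hψ.1 hψ.2⟩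

/-! ### The Anzai skew-product -/

/-- The pair `(e^{iθ} u, f(u) v)`, which satisfies the same relation as `(u, v)`. -/
def Rep.skew {α : ℝ} (θ : ℝ) (f : C(Circle, Circle)) (i : Rep.{u} α) : Rep.{u} α where
  carrier := i.carrier
  u := (Circle.exp θ : ℂ) • i.u
  v := circleFun f i.u * i.v
  u_mem := smul_mem_unitary i.u_mem _
  v_mem := mul_mem (circleFun_mem_unitary i.u_mem f) i.v_mem
  rel := by
    have hc := circleFun_commute i.u f
    rw [smul_mul_assoc, mul_smul_comm, smul_comm, ← mul_assoc, hc.eq, mul_assoc, i.rel,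
      mul_smul_comm, ← mul_assoc]

/-- Precomposition with `Rep.skew` on the product. -/
def prodSkew (α θ : ℝ) (f : C(Circle, Circle)) : RepProd.{u} α →⋆ₐ[ℂ] RepProd.{u} α where
  toFun x := ⟨fun i => x (i.skew θ f), memℓp_infty ⟨‖x‖, by
    rintro _ ⟨i, rfl⟩
    exact lp.norm_apply_le_norm ENNReal.top_ne_zero x (i.skew θ f)⟩⟩
  map_one' := rfl
  map_mul' _ _ := rfl
  map_zero' := rfl
  map_add' _ _ := rfl
  commutes' _ := rfl
  map_star' _ := rfl

lemma eval_circleFun {α : ℝ} (f : C(Circle, Circle)) (i : Rep.{u} α) :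
    eval i (circleFun f (genU α)) = circleFun f i.u :=
  StarAlgHom.map_cfc (eval i) (circleExt f) (genU α)
    (continuousOn_circleExt_spectrum (genU_mem_unitary α) f)
    (map_continuous (eval i))
    (isStarNormal_of_unitary (genU_mem_unitary α)) (isStarNormal_of_unitary i.u_mem)

lemma prodSkew_U (α θ : ℝ) (f : C(Circle, Circle)) :
    prodSkew α θ f (prodU.{u} α) = (((Circle.exp θ : ℂ) • genU α : NCTorus.{u} α) : RepProd α) :=
  rfl

lemma prodSkew_V (α θ : ℝ) (f : C(Circle, Circle)) :
    prodSkew α θ f (prodV.{u} α) = ((circleFun f (genU α) * genV α : NCTorus.{u} α) : RepProd α) :=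
  lp.ext (funext fun i => congrArg (· * i.v) (eval_circleFun f i).symm)

lemma prodSkew_mem (α θ : ℝ) (f : C(Circle, Circle)) (x : NCTorus.{u} α) :
    prodSkew α θ f x ∈ ncTorus.{u} α := by
  have hc : Continuous (prodSkew.{u} α θ f) := map_continuous (prodSkew.{u} α θ f)
  have h : ncTorus.{u} α ≤ (ncTorus.{u} α).comap (prodSkew α θ f) := by
    refine StarSubalgebra.topologicalClosure_minimal ?_ ((ncTorus_isClosed α).preimage hc)
    refine StarAlgebra.adjoin_le ?_
    rintro _ (rfl | rfl)
    · change prodSkew α θ f (prodU α) ∈ ncTorus.{u} α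
      rw [prodSkew_U]
      exact Subtype.property _
    · change prodSkew α θ f (prodV α) ∈ ncTorus.{u} α
      rw [prodSkew_V]
      exact Subtype.property _
  exact h x.2

/-- The Anzai skew-product as an endomorphism of `𝔸_α`. -/
def anzaiHom (α θ : ℝ) (f : C(Circle, Circle)) : NCTorus.{u} α →⋆ₐ[ℂ] NCTorus.{u} α :=
  ((prodSkew α θ f).comp (ncTorus.{u} α).subtype).codRestrict (ncTorus.{u} α)
    (prodSkew_mem α θ f)

lemma anzaiHom_genU (α θ : ℝ) (f : C(Circle, Circle)) :
    anzaiHom α θ f (genU.{u} α) = (Circle.exp θ : ℂ) • genU α :=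
  Subtype.ext (prodSkew_U α θ f)

lemma anzaiHom_genV (α θ : ℝ) (f : C(Circle, Circle)) :
    anzaiHom α θ f (genV.{u} α) = circleFun f (genU α) * genV α :=
  Subtype.ext (prodSkew_V α θ f)

lemma circleFun_smul {B : Type*} [CStarAlgebra B] {w : B} (hw : w ∈ unitary B) (c : Circle)
    (f : C(Circle, Circle)) :
    circleFun f ((c : ℂ) • w) = circleFun (f.comp (ContinuousMap.mulLeft c)) w := by
  have hn := isStarNormal_of_unitary hw
  have hs := spectrum_subset_circle hw
  have hc : ContinuousOn (circleExt f) ((fun x => (c : ℂ) • x) '' spectrum ℂ w) := by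
    refine (continuousOn_circleExt f).mono ?_
    rintro _ ⟨x, hx, rfl⟩
    have := hs hx
    simp only [mem_sphere_zero_iff_norm] at this ⊢
    rw [norm_smul, this, Circle.norm_coe, one_mul]
  unfold circleFun
  rw [← cfc_comp_smul (c : ℂ) (circleExt f) w hc hn]
  refine cfc_congr fun x hx => ?_
  obtain ⟨z, rfl⟩ : ∃ z : Circle, (z : ℂ) = x := ⟨⟨x, hs hx⟩, rfl⟩
  change circleExt f ((c * z : Circle) : ℂ) = _
  rw [circleExt_coe, circleExt_coe]
  rfl

lemma circleFun_mul_eq_one {B : Type*} [CStarAlgebra B] {w : B} (hw : w ∈ unitary B)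
    {f g : C(Circle, Circle)} (h : ∀ z, f z * g z = 1) : circleFun f w * circleFun g w = 1 := by
  have hn := isStarNormal_of_unitary hw
  unfold circleFun
  rw [← cfc_mul _ _ w (continuousOn_circleExt_spectrum hw f)
    (continuousOn_circleExt_spectrum hw g), ← cfc_one ℂ w]
  refine cfc_congr fun x hx => ?_
  obtain ⟨z, rfl⟩ : ∃ z : Circle, (z : ℂ) = x := ⟨⟨x, spectrum_subset_circle hw hx⟩, rfl⟩
  rw [circleExt_coe, circleExt_coe, ← Circle.coe_mul, h]
  rfl

/-- The function that belongs to the inverse of the skew-product. -/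
def skewInv (θ : ℝ) (f : C(Circle, Circle)) : C(Circle, Circle) :=
  (f.comp (ContinuousMap.mulLeft (Circle.exp (-θ))))⁻¹

lemma skewInv_skewInv (θ : ℝ) (f : C(Circle, Circle)) : skewInv (-θ) (skewInv θ f) = f := by
  ext z
  simp [skewInv]

lemma anzaiHom_inv_comp (α θ : ℝ) (f : C(Circle, Circle)) :
    (anzaiHom.{u} α (-θ) (skewInv θ f)).comp (anzaiHom α θ f) = StarAlgHom.id ℂ _ := by
  set Ψ := anzaiHom.{u} α (-θ) (skewInv θ f) with hΨ
  have hU := genU_mem_unitary.{u} α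
  have hΨU : Ψ (genU α) = (Circle.exp (-θ) : ℂ) • genU α := anzaiHom_genU α (-θ) _
  have hΨf : Ψ (circleFun f (genU α)) = circleFun f ((Circle.exp (-θ) : ℂ) • genU α) := by
    have := StarAlgHom.map_cfc Ψ (circleExt f) (genU α) (continuousOn_circleExt_spectrum hU f)
      (map_continuous Ψ) (isStarNormal_of_unitary hU)
      (by rw [hΨU]; exact isStarNormal_of_unitary (smul_mem_unitary hU _))
    rwa [hΨU] at this
  refine hom_ext ?_ ?_
  · rw [StarAlgHom.comp_apply, anzaiHom_genU, map_smul, hΨU, smul_smul, ← Circle.coe_mul,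
      ← Circle.exp_add]
    simp
  · rw [StarAlgHom.comp_apply, anzaiHom_genV, map_mul, hΨf, hΨ, anzaiHom_genV, circleFun_smul hU,
      ← mul_assoc, circleFun_mul_eq_one hU, one_mul]
    · rfl
    · intro z
      simp [skewInv]

/-- The Anzai skew-product `Φ_{θ,f}`: the *-automorphism of `𝔸_α` with
`Φ(U) = e^{iθ} U` and `Φ(V) = f(U) V`. -/
def anzai (α θ : ℝ) (f : C(Circle, Circle)) : NCTorus.{u} α ≃⋆ₐ[ℂ] NCTorus.{u} α :=
  StarAlgEquiv.ofStarAlgHom (anzaiHom α θ f) (anzaiHom α (-θ) (skewInv θ f))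
    (anzaiHom_inv_comp α θ f)
    (by
      have := anzaiHom_inv_comp.{u} α (-θ) (skewInv θ f)
      rwa [skewInv_skewInv, neg_neg] at this)

lemma anzai_genU (α θ : ℝ) (f : C(Circle, Circle)) :
    anzai α θ f (genU.{u} α) = (Circle.exp θ : ℂ) • genU α :=
  anzaiHom_genU α θ f

lemma anzai_genV (α θ : ℝ) (f : C(Circle, Circle)) :
    anzai α θ f (genV.{u} α) = circleFun f (genU α) * genV α :=
  anzaiHom_genV α θ f

/-! ### The cohomological equation -/

/-- The functions `f_n`: `f_n(z) = ∏_{0 ≤ l < n} f(e^{-2πilα} z)` for `n ≥ 0` and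
`f_n(z) = ∏_{1 ≤ l ≤ |n|} conj f(e^{2πilα} z)` for `n < 0`. -/
def cocycle (α : ℝ) (f : C(Circle, Circle)) (n : ℤ) (z : Circle) : Circle :=
  if 0 ≤ n then ∏ l ∈ Finset.range n.natAbs, f (Circle.exp (-(2 * Real.pi * (l * α))) * z)
  else ∏ l ∈ Finset.Icc 1 n.natAbs, (f (Circle.exp (2 * Real.pi * (l * α)) * z))⁻¹

/-- `g` solves `(g ∘ R_{θ/2π}) f_n = g`, as an identity in `L²`. -/
def SolvesCohomological (α θ : ℝ) (f : C(Circle, Circle)) (n : ℤ) (g : Lp ℂ 2 circleHaar) : Prop :=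
  ∀ᵐ z ∂circleHaar, g (Circle.exp θ * z) * (cocycle α f n z : ℂ) = g z

/-! ### Cesàro means, states and unique ergodicity -/

/-- The Cesàro mean `(1/n) ∑_{k<n} Φ^k(a)`. -/
def cesaroMean {A : Type*} [AddCommMonoid A] [Module ℂ A] (Φ : A → A) (a : A) (n : ℕ) : A :=
  (n : ℂ)⁻¹ • ∑ k ∈ Finset.range n, Φ^[k] a

/-- States of a unital *-algebra: unital positive linear functionals (on a C*-algebra these are
automatically continuous). -/
structure IsState {A : Type*} [Ring A] [StarRing A] [Algebra ℂ A] (φ : A →ₗ[ℂ] ℂ) : Prop where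
  map_one : φ 1 = 1
  nonneg : ∀ a, 0 ≤ (φ (star a * a)).re ∧ (φ (star a * a)).im = 0

/-- The fixed-point subalgebra `A^Φ`. -/
def fixedSubalgebra {A : Type*} [CStarAlgebra A] (Φ : A ≃⋆ₐ[ℂ] A) : StarSubalgebra ℂ A :=
  StarAlgHom.equalizer (Φ : A →⋆ₐ[ℂ] A) (StarAlgHom.id ℂ A)

/-- Unique ergodicity with respect to the fixed-point subalgebra: every state of `A^Φ` has exactly
one `Φ`-invariant extension to a state of `A`. -/
def UniquelyErgodicRelFixed {A : Type*} [CStarAlgebra A] (Φ : A ≃⋆ₐ[ℂ] A) : Prop :=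
  ∀ ψ : fixedSubalgebra Φ →ₗ[ℂ] ℂ, IsState ψ →
    ∃! φ : A →ₗ[ℂ] ℂ, IsState φ ∧ (∀ a, φ (Φ a) = φ a) ∧ ∀ b : fixedSubalgebra Φ, φ b = ψ b

end NCAnzai
end

/-! Each point `z` of the circle gives a representation of the torus on `ℓ²(ℤ)` (`pointRep`), and
the matrix coefficients of an element `x` are continuous functions of `z` (`continuous_coeff`). The
skew-product moves `z` to `e^{iθ} z` and conjugates by a diagonal unitary built from the cocycle
(`pointHom_anzai`), so the coefficient of index `(0, -n)` of a fixed point is a continuous solution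
of the cohomological equation.

By ergodicity of the rotation, `g` can be rescaled to a unimodular solution `γ`, and every
measurable solution is a multiple of `γ`. As `γ` is not continuous, this coefficient vanishes for
every fixed point (`coeff_ae_eq_zero_of_fixed`).

On the other hand, averaging the vector states of `(e_0 + conj γ(z) e_{-n})/√2` over `z` gives an
invariant state (`solutionState`), and `-γ` gives another. They differ only through the coefficients
`(0, -n)` and `(-n, 0)`, so they agree on the fixed-point algebra, but they are distinct because
some Fourier coefficient of `γ` is nonzero. This refutes unique ergodicity. Their difference `L` is
invariant and kills fixed points; a weak limit of the Cesàro means of `a` would be a fixed point `b`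
with `L b = L a`, which is impossible when `L a ≠ 0` (`not_tendsto_cesaroMean`). -/

noncomputable section

namespace NCAnzai

open scoped CStarAlgebra ComplexConjugate

/-! ### Continuous functional calculus on eigenvectors -/

/-- Polynomials in `T` and `star T` act on `v` by evaluation at `c`, and these are dense by
Stone–Weierstrass. That `v ≠ 0` is what puts `c` in the spectrum. -/
lemma cfc_apply_eigenvector {H : Type*} [NormedAddCommGroup H] [InnerProductSpace ℂ H]
    [CompleteSpace H] {T : H →L[ℂ] H} [hT : IsStarNormal T] {v : H} (hv : v ≠ 0) {c : ℂ}
    (h : T v = c • v) (h' : (star T) v = conj c • v) {F : ℂ → ℂ}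
    (hF : ContinuousOn F (spectrum ℂ T)) : (cfc F T) v = F c • v := by
  have hc : c ∈ spectrum ℂ T := by
    rw [spectrum.mem_iff]
    intro hu
    refine hv ?_
    have h0 : (algebraMap ℂ (H →L[ℂ] H) c - T) v = 0 := by
      simp [h, Algebra.algebraMap_eq_smul_one]
    obtain ⟨w, hw⟩ := hu
    have : (↑w⁻¹ * (w : H →L[ℂ] H)) v = 0 := by
      rw [mul_apply_eq_comp, hw, h0, map_zero]
    simpa using this
  have key : ∀ k : C(spectrum ℂ T, ℂ), (cfcHom hT k) v = k ⟨c, hc⟩ • v := by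
    intro k
    induction k using ContinuousMap.induction_on_of_compact with
    | const r =>
      have : ContinuousMap.const (spectrum ℂ T) r = algebraMap ℂ C(spectrum ℂ T, ℂ) r := rfl
      rw [this, AlgHomClass.commutes]
      simp [Algebra.algebraMap_eq_smul_one]
    | id => rw [cfcHom_id hT]; exact h
    | star_id => rw [map_star, cfcHom_id hT]; exact h'
    | add f g hf hg => rw [map_add, add_apply, hf, hg, ← add_smul]; rfl
    | mul f g hf hg =>
      rw [map_mul, mul_apply_eq_comp, hg, map_smul, hf, smul_smul, mul_comm]; rfl
    | frequently f hf =>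
      refine hf.mem_of_closed (isClosed_eq ?_ ?_)
      · exact (ContinuousLinearMap.apply ℂ H v).continuous.comp (cfcHom_continuous hT)
      · exact (ContinuousEvalConst.continuous_eval_const _).smul continuous_const
  rw [cfc_apply F T hT hF, key]
  rfl

/-! ### Weighted shifts on `ℓ²(ℤ)` -/

/-- The Hilbert space `ℓ²(ℤ)`, in an arbitrary universe. -/
abbrev EllTwo : Type u := lp (fun _ : ULift.{u} ℤ => ℂ) 2

/-- The standard basis of `ℓ²(ℤ)`. -/
def basisVec (k : ℤ) : EllTwo.{u} := lp.single 2 (ULift.up k) (1 : ℂ)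

lemma basisVec_apply (k : ℤ) (i : ULift.{u} ℤ) :
    basisVec.{u} k i = if i.down = k then 1 else 0 := by
  rw [basisVec, lp.single_apply, Pi.single_apply]
  congr 1
  rw [ULift.ext_iff]

lemma norm_basisVec (k : ℤ) : ‖basisVec.{u} k‖ = 1 := by
  rw [basisVec, lp.norm_single (by norm_num)]
  simp

lemma basisVec_ne_zero (k : ℤ) : basisVec.{u} k ≠ 0 := by
  intro h
  simpa [h] using norm_basisVec.{u} k

lemma inner_basisVec (k : ℤ) (x : EllTwo.{u}) : inner ℂ (basisVec k) x = x ⟨k⟩ := by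
  rw [basisVec, lp.inner_single_left]
  simp

/-- The bijection `k ↦ k + m` of the index set. -/
def shiftPerm (m : ℤ) : ULift.{u} ℤ ≃ ULift.{u} ℤ :=
  Equiv.ulift.trans ((Equiv.addRight m).trans Equiv.ulift.symm)

lemma shift_memℓp (m : ℤ) (c : ℤ → Circle) (x : EllTwo.{u}) :
    Memℓp (fun i : ULift.{u} ℤ => (c i.down : ℂ) * x (shiftPerm m i)) 2 := by
  rw [memℓp_gen_iff (by norm_num)]
  have h := (memℓp_gen_iff (p := 2) (by norm_num)).1 (lp.memℓp x)
  simp only [norm_mul, Circle.norm_coe, one_mul]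
  exact (shiftPerm.{u} m).summable_iff.2 h

/-- The unitary operator `(W x)_k = c_k x_{k+m}`. -/
def weightedShift (m : ℤ) (c : ℤ → Circle) : EllTwo.{u} ≃ₗᵢ[ℂ] EllTwo.{u} where
  toFun x := ⟨_, shift_memℓp m c x⟩
  -- Solving `y_{k-m} = c_{k-m} x_k` for `x_k` shifts the index of the weight too.
  invFun x := ⟨_, shift_memℓp (-m) (fun k => (c (k - m))⁻¹) x⟩
  map_add' x y := by
    ext i
    exact mul_add _ _ _
  map_smul' r x := by
    ext i
    exact mul_left_comm _ _ _
  left_inv x := by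
    ext i
    change ((c (i.down - m))⁻¹ : Circle) * ((c (i.down + -m) : ℂ) *
      x (shiftPerm m (shiftPerm (-m) i))) = x i
    rw [← mul_assoc, ← Circle.coe_mul, sub_eq_add_neg, inv_mul_cancel, Circle.coe_one, one_mul]
    simp [shiftPerm]
  right_inv x := by
    ext i
    change (c i.down : ℂ) * (((c (i.down + m - m))⁻¹ : Circle) *
      x (shiftPerm (-m) (shiftPerm m i))) = x i
    rw [← mul_assoc, ← Circle.coe_mul, add_sub_cancel_right, mul_inv_cancel, Circle.coe_one,
      one_mul]
    simp [shiftPerm]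
  norm_map' x := by
    rw [lp.norm_eq_tsum_rpow (by norm_num), lp.norm_eq_tsum_rpow (by norm_num)]
    congr 1
    rw [← (shiftPerm.{u} m).tsum_eq fun i => ‖x i‖ ^ (2 : ℝ≥0∞).toReal]
    refine tsum_congr fun i => ?_
    change ‖(c i.down : ℂ) * x (shiftPerm m i)‖ ^ _ = _
    rw [norm_mul, Circle.norm_coe, one_mul]

/-- `weightedShift` as an element of the C*-algebra of bounded operators. -/
def shiftOp (m : ℤ) (c : ℤ → Circle) : EllTwo.{u} →L[ℂ] EllTwo.{u} := weightedShift m c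

lemma shiftOp_apply (m : ℤ) (c : ℤ → Circle) (x : EllTwo.{u}) (k : ℤ) :
    shiftOp m c x ⟨k⟩ = c k * x ⟨k + m⟩ := rfl

lemma star_shiftOp_apply (m : ℤ) (c : ℤ → Circle) (x : EllTwo.{u}) (k : ℤ) :
    (star (shiftOp m c)) x ⟨k⟩ = ((c (k - m))⁻¹ : Circle) * x ⟨k - m⟩ := by
  rw [shiftOp, LinearIsometryEquiv.star_eq_symm]
  rfl

lemma shiftOp_mem_unitary (m : ℤ) (c : ℤ → Circle) :
    shiftOp.{u} m c ∈ unitary (EllTwo.{u} →L[ℂ] EllTwo.{u}) := by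
  rw [Unitary.mem_iff, shiftOp, LinearIsometryEquiv.star_eq_symm]
  constructor <;> ext x : 1
  · exact (weightedShift m c).symm_apply_apply x
  · exact (weightedShift m c).apply_symm_apply x

lemma shiftOp_basisVec (m : ℤ) (c : ℤ → Circle) (k : ℤ) :
    shiftOp m c (basisVec.{u} k) = (c (k - m) : ℂ) • basisVec (k - m) := by
  ext ⟨i⟩
  rw [shiftOp_apply, lp.coeFn_smul, Pi.smul_apply, basisVec_apply, basisVec_apply]
  by_cases h : i = k - m
  · simp [h]
  · simp [h, eq_sub_iff_add_eq.not.1 h]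

lemma star_shiftOp_basisVec (m : ℤ) (c : ℤ → Circle) (k : ℤ) :
    (star (shiftOp m c)) (basisVec.{u} k) = conj (c k : ℂ) • basisVec (k + m) := by
  ext ⟨i⟩
  rw [star_shiftOp_apply, lp.coeFn_smul, Pi.smul_apply, basisVec_apply, basisVec_apply]
  by_cases h : i = k + m
  · simp [h, ← Circle.coe_inv_eq_conj]
  · simp [h, sub_eq_iff_eq_add.not.2 h]

lemma continuousLinearMap_ext_basisVec {S T : EllTwo.{u} →L[ℂ] EllTwo.{u}}
    (h : ∀ k, S (basisVec k) = T (basisVec k)) : S = T := by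
  refine lp.ext_continuousLinearMap (by norm_num) fun i => ?_
  ext : 1
  exact h i.down

/-! ### The representations of the noncommutative torus attached to the points of the circle -/

/-- The orbit `k ↦ e^{2πikα}` of the rotation. -/
def rotSeq (α : ℝ) (k : ℤ) : Circle := Circle.exp (2 * Real.pi * (k * α))

lemma rotSeq_zero (α : ℝ) : rotSeq α 0 = 1 := by simp [rotSeq]

lemma rotSeq_add_one (α : ℝ) (k : ℤ) :
    rotSeq α (k + 1) = Circle.exp (2 * Real.pi * α) * rotSeq α k := by
  rw [rotSeq, rotSeq, ← Circle.exp_add]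
  congr 1
  push_cast
  ring

instance : Nontrivial EllTwo.{u} := ⟨basisVec 0, 0, basisVec_ne_zero 0⟩

/-- The representation on `ℓ²(ℤ)` with `U e_k = e^{2πikα} z e_k` and `V e_k = e_{k+1}`. -/
def pointRep (α : ℝ) (z : Circle) : Rep.{u} α where
  carrier := EllTwo.{u} →L[ℂ] EllTwo.{u}
  u := (z : ℂ) • shiftOp 0 (rotSeq α)
  -- `shiftOp m` lowers basis indices by `m`, so `-1` raises them by one.
  v := shiftOp (-1) 1
  u_mem := smul_mem_unitary (shiftOp_mem_unitary _ _) z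
  v_mem := shiftOp_mem_unitary _ _
  rel := by
    refine continuousLinearMap_ext_basisVec fun k => ?_
    simp only [mul_apply_eq_comp, smul_apply, shiftOp_basisVec, map_smul,
      smul_smul, Pi.one_apply, sub_neg_eq_add, sub_zero, Circle.coe_one, mul_one, one_mul,
      rotSeq_add_one, Circle.coe_mul]
    congr 1
    ring

/-- The homomorphism given by `pointRep`. -/
def pointHom (α : ℝ) (z : Circle) :
    NCTorus.{u} α →⋆ₐ[ℂ] (EllTwo.{u} →L[ℂ] EllTwo.{u}) := eval (pointRep α z)

lemma pointHom_genU (α : ℝ) (z : Circle) :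
    pointHom.{u} α z (genU α) = (z : ℂ) • shiftOp 0 (rotSeq α) := rfl

lemma pointHom_genV (α : ℝ) (z : Circle) : pointHom.{u} α z (genV α) = shiftOp (-1) 1 := rfl

lemma norm_pointHom_le (α : ℝ) (z : Circle) (x : NCTorus.{u} α) : ‖pointHom α z x‖ ≤ ‖x‖ :=
  NonUnitalStarAlgHom.norm_apply_le (pointHom α z) x

lemma pointHom_genU_basisVec (α : ℝ) (z : Circle) (k : ℤ) :
    pointHom α z (genU α) (basisVec.{u} k) = ((rotSeq α k * z : Circle) : ℂ) • basisVec k := by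
  rw [pointHom_genU, smul_apply, shiftOp_basisVec, smul_smul, sub_zero,
    Circle.coe_mul, mul_comm]

lemma star_pointHom_genU_basisVec (α : ℝ) (z : Circle) (k : ℤ) :
    (star (pointHom α z (genU α))) (basisVec.{u} k) =
      conj ((rotSeq α k * z : Circle) : ℂ) • basisVec k := by
  rw [pointHom_genU, star_smul, smul_apply, star_shiftOp_basisVec, smul_smul,
    add_zero, Circle.coe_mul, map_mul, mul_comm]
  rfl

lemma pointHom_genV_basisVec (α : ℝ) (z : Circle) (k : ℤ) :
    pointHom α z (genV α) (basisVec.{u} k) = basisVec (k + 1) := by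
  rw [pointHom_genV, shiftOp_basisVec, sub_neg_eq_add]
  simp

lemma pointHom_circleFun_basisVec (α : ℝ) (z : Circle) (f : C(Circle, Circle)) (k : ℤ) :
    pointHom α z (circleFun f (genU α)) (basisVec.{u} k) =
      (f (rotSeq α k * z) : ℂ) • basisVec k := by
  have hu := (pointRep.{u} α z).u_mem
  have : IsStarNormal (pointHom.{u} α z (genU α)) := isStarNormal_of_unitary hu
  have he : pointHom.{u} α z (circleFun f (genU α)) = circleFun f (pointHom α z (genU α)) :=
    eval_circleFun f (pointRep α z)
  rw [he]
  exact (cfc_apply_eigenvector (T := pointHom α z (genU α)) (basisVec_ne_zero k)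
    (pointHom_genU_basisVec α z k) (star_pointHom_genU_basisVec α z k)
    (continuousOn_circleExt_spectrum hu f)).trans (by rw [circleExt_coe])

/-! ### Strong continuity in the point -/

/-- Induction principle for elements of the noncommutative torus. -/
lemma ncTorus_induction {α : ℝ} {p : NCTorus.{u} α → Prop} (hU : p (genU α)) (hV : p (genV α))
    (hc : ∀ c : ℂ, p (algebraMap ℂ _ c)) (hadd : ∀ x y, p x → p y → p (x + y))
    (hmul : ∀ x y, p x → p y → p (x * y)) (hstar : ∀ x, p x → p (star x))
    (hcl : IsClosed {x | p x}) (x : NCTorus.{u} α) : p x := by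
  -- The induction runs in the ambient product, so membership in the torus is carried along with
  -- `p`.
  have key : ∀ y ∈ StarAlgebra.adjoin ℂ {prodU.{u} α, prodV α},
      ∃ h : y ∈ ncTorus α, p ⟨y, h⟩ := by
    intro y hy
    induction hy using StarAlgebra.adjoin_induction with
    | mem y hy =>
      rcases hy with rfl | rfl
      · exact ⟨_, hU⟩
      · exact ⟨_, hV⟩
    | algebraMap r => exact ⟨_, hc r⟩
    | add x y _ _ hx hy =>
      obtain ⟨hx, hpx⟩ := hx
      obtain ⟨hy, hpy⟩ := hy
      exact ⟨_, hadd _ _ hpx hpy⟩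
    | mul x y _ _ hx hy =>
      obtain ⟨hx, hpx⟩ := hx
      obtain ⟨hy, hpy⟩ := hy
      exact ⟨_, hmul _ _ hpx hpy⟩
    | star x _ hx =>
      obtain ⟨hx, hpx⟩ := hx
      exact ⟨_, hstar _ hpx⟩
  have hd : Dense {x : NCTorus.{u} α | p x} := by
    rw [Subtype.dense_iff]
    intro y hy
    refine closure_mono ?_ hy
    intro w hw
    obtain ⟨h, hp⟩ := key w hw
    exact ⟨⟨w, h⟩, hp, rfl⟩
  have := hd.closure_eq ▸ Set.mem_univ x
  rwa [hcl.closure_eq] at this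

/-- The vector varies with `z` so that products can be treated by composition. The statement for
`star x` is carried along because strong continuity does not pass to adjoints. -/
lemma continuous_pointHom_apply_and_star {α : ℝ} (x : NCTorus.{u} α) :
    (∀ η : Circle → EllTwo.{u}, Continuous η → Continuous fun z => pointHom α z x (η z)) ∧
      ∀ η : Circle → EllTwo.{u}, Continuous η →
        Continuous fun z => pointHom α z (star x) (η z) := by
  induction x using ncTorus_induction with
  | hU =>
    refine ⟨fun η hη => ?_, fun η hη => ?_⟩
    · simp only [pointHom_genU, smul_apply]
      exact continuous_subtype_val.smul ((shiftOp 0 (rotSeq α)).continuous.comp hη)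
    · simp only [map_star, pointHom_genU, star_smul, smul_apply]
      exact continuous_subtype_val.star.smul ((star (shiftOp 0 (rotSeq α))).continuous.comp hη)
  | hV =>
    refine ⟨fun η hη => ?_, fun η hη => ?_⟩
    · simp only [pointHom_genV]
      exact (shiftOp (-1) 1).continuous.comp hη
    · simp only [map_star, pointHom_genV]
      exact (star (shiftOp (-1) 1)).continuous.comp hη
  | hc c =>
    refine ⟨fun η hη => ?_, fun η hη => ?_⟩
    · simp only [AlgHomClass.commutes]
      exact (algebraMap ℂ (EllTwo.{u} →L[ℂ] EllTwo.{u}) c).continuous.comp hη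
    · simp only [map_star, AlgHomClass.commutes]
      exact (star (algebraMap ℂ (EllTwo.{u} →L[ℂ] EllTwo.{u}) c)).continuous.comp hη
  | hadd x y hx hy =>
    refine ⟨fun η hη => ?_, fun η hη => ?_⟩
    · simp only [map_add, add_apply]
      exact (hx.1 η hη).add (hy.1 η hη)
    · simp only [star_add, map_add, add_apply]
      exact (hx.2 η hη).add (hy.2 η hη)
  | hmul x y hx hy =>
    refine ⟨fun η hη => ?_, fun η hη => ?_⟩
    · simp only [map_mul, mul_apply_eq_comp]
      exact hx.1 _ (hy.1 η hη)
    · simp only [star_mul, map_mul, mul_apply_eq_comp]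
      exact hy.2 _ (hx.2 η hη)
  | hstar x hx => exact ⟨hx.2, by simpa only [star_star] using hx.1⟩
  | hcl =>
    have hclosed : IsClosed {x : NCTorus.{u} α |
        ∀ η : Circle → EllTwo.{u}, Continuous η → Continuous fun z => pointHom α z x (η z)} := by
      simp only [Set.ofPred_forall]
      refine isClosed_iInter fun η => isClosed_iInter fun hη => ?_
      refine isClosed_of_closure_subset fun x hx => ?_
      -- Compactness of the circle bounds `η`, so norm approximation of `x` is uniform approximation
      -- in `z`.
      obtain ⟨C, hC⟩ := (isCompact_range hη).isBounded.exists_norm_le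
      have hC' : ∀ z, ‖η z‖ ≤ C := fun z => hC _ ⟨z, rfl⟩
      have hC0 : 0 ≤ C := (norm_nonneg _).trans (hC' 1)
      refine continuous_of_uniform_approx_of_continuous fun s hs => ?_
      obtain ⟨ε, hε, hs⟩ := Metric.mem_uniformity_dist.1 hs
      obtain ⟨y, hy, hxy⟩ := Metric.mem_closure_iff.1 hx (ε / (C + 1)) (by positivity)
      refine ⟨_, hy, fun z => hs ?_⟩
      rw [dist_eq_norm, ← sub_apply, ← map_sub]
      calc ‖pointHom α z (x - y) (η z)‖ ≤ ‖x - y‖ * C :=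
            ContinuousLinearMap.le_of_opNorm_le_of_le _ (norm_pointHom_le α z _) (hC' z)
        _ ≤ ‖x - y‖ * (C + 1) := by gcongr; linarith
        _ < ε := by
          rw [dist_eq_norm] at hxy
          exact (lt_div_iff₀ (by positivity)).1 hxy
    exact hclosed.inter (hclosed.preimage continuous_star)

/-! ### Matrix coefficients -/

/-- The matrix coefficients of an element of the noncommutative torus, as functions of the
point of the circle. -/
def coeff {α : ℝ} (i j : ℤ) (x : NCTorus.{u} α) (z : Circle) : ℂ :=
  inner ℂ (basisVec i) (pointHom α z x (basisVec j))

lemma continuous_coeff {α : ℝ} (i j : ℤ) (x : NCTorus.{u} α) : Continuous (coeff i j x) :=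
  continuous_const.inner ((continuous_pointHom_apply_and_star x).1 _ continuous_const)

lemma norm_coeff_le {α : ℝ} (i j : ℤ) (x : NCTorus.{u} α) (z : Circle) :
    ‖coeff i j x z‖ ≤ ‖x‖ := by
  refine (norm_inner_le_norm _ _).trans ?_
  rw [norm_basisVec, one_mul]
  have := ContinuousLinearMap.le_of_opNorm_le (pointHom α z x) (norm_pointHom_le α z x)
    (basisVec j)
  rwa [norm_basisVec, mul_one] at this

lemma coeff_add {α : ℝ} (i j : ℤ) (x y : NCTorus.{u} α) (z : Circle) :
    coeff i j (x + y) z = coeff i j x z + coeff i j y z := by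
  simp only [coeff, map_add, add_apply, inner_add_right]

lemma coeff_smul {α : ℝ} (i j : ℤ) (c : ℂ) (x : NCTorus.{u} α) (z : Circle) :
    coeff i j (c • x) z = c * coeff i j x z := by
  simp only [coeff, map_smul, smul_apply, inner_smul_right]

/-! ### The skew-product in the point representations. -/

/-- The unimodular sequences that implement the skew-product in the representations
`pointRep`. -/
def diagSeq (α : ℝ) (f : C(Circle, Circle)) (z : Circle) (k : ℤ) : Circle :=
  (cocycle α f (-k) z)⁻¹

lemma cocycle_zero (α : ℝ) (f : C(Circle, Circle)) (z : Circle) : cocycle α f 0 z = 1 := by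
  simp [cocycle]

/-- One recursion valid for both signs of `n`; all later use of the cocycle at shifted indices goes
through it. -/
lemma cocycle_add_one (α : ℝ) (f : C(Circle, Circle)) (n : ℤ) (z : Circle) :
    cocycle α f (n + 1) z = f (rotSeq α (-n) * z) * cocycle α f n z := by
  obtain ⟨m, rfl | rfl⟩ := n.eq_nat_or_neg
  · have h : ((m : ℤ) + 1).natAbs = m + 1 := by omega
    rw [cocycle, cocycle, if_pos (by omega), if_pos (by omega), h, Int.natAbs_natCast,
      Finset.prod_range_succ, mul_comm, rotSeq]
    congr 4
    push_cast
    ring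
  · rcases m with _ | m
    · simp [cocycle, rotSeq]
    · have h : (-((m + 1 : ℕ) : ℤ) + 1) = -(m : ℤ) := by push_cast; ring
      have h1 : (-((m + 1 : ℕ) : ℤ)).natAbs = m + 1 := by omega
      -- For `m = 0` the cocycle falls in its nonnegative branch, but both products are empty.
      have h2 : cocycle α f (-(m : ℤ)) z =
          ∏ l ∈ Finset.Icc 1 m, (f (Circle.exp (2 * Real.pi * (l * α)) * z))⁻¹ := by
        rcases m with _ | m
        · simp [cocycle]
        · rw [cocycle, if_neg (by omega), Int.natAbs_neg, Int.natAbs_natCast]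
      rw [h, h2, cocycle, if_neg (by omega), h1, Finset.prod_Icc_succ_top (by omega), neg_neg,
        rotSeq, mul_left_comm]
      push_cast
      rw [mul_inv_cancel, mul_one]

lemma diagSeq_zero (α : ℝ) (f : C(Circle, Circle)) (z : Circle) : diagSeq α f z 0 = 1 := by
  simp [diagSeq, cocycle_zero]

/-- The index `k + 1` in the rotation is the right one: in `f(U) V e_k` the factor `f(U)` acts on
`e_{k+1}`. -/
lemma diagSeq_add_one (α : ℝ) (f : C(Circle, Circle)) (z : Circle) (k : ℤ) :
    diagSeq α f z (k + 1) = f (rotSeq α (k + 1) * z) * diagSeq α f z k := by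
  have h := cocycle_add_one α f (-(k + 1)) z
  have h' : -(k + 1) + 1 = -k := by ring
  rw [h', neg_neg] at h
  rw [diagSeq, diagSeq, h, mul_inv, mul_inv_cancel_left]

/-- Both sides are *-homomorphisms in `x`, so the generators suffice. At `U` everything is diagonal
and the conjugation cancels; at `V` it produces the ratio of consecutive weights, which is the value
of `f` required. -/
lemma pointHom_anzai (α θ : ℝ) (f : C(Circle, Circle)) (z : Circle) (x : NCTorus.{u} α) :
    pointHom α z (anzai α θ f x) = shiftOp 0 (diagSeq α f z) *
      pointHom α (Circle.exp θ * z) x * star (shiftOp 0 (diagSeq α f z)) := by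
  have h : (pointHom.{u} α z).comp (anzai α θ f : NCTorus.{u} α →⋆ₐ[ℂ] NCTorus.{u} α) =
      ((Unitary.conjStarAlgAut ℂ _ ⟨_, shiftOp_mem_unitary.{u} 0 (diagSeq α f z)⟩ :
        _ ≃⋆ₐ[ℂ] _) : _ →⋆ₐ[ℂ] _).comp (pointHom α (Circle.exp θ * z)) := by
    refine hom_ext ?_ ?_
    · change pointHom α z (anzai α θ f (genU α)) = shiftOp 0 (diagSeq α f z) *
        pointHom α (Circle.exp θ * z) (genU α) * star (shiftOp 0 (diagSeq α f z))
      rw [anzai_genU, map_smul]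
      refine continuousLinearMap_ext_basisVec fun k => ?_
      simp only [mul_apply_eq_comp, smul_apply, star_shiftOp_basisVec,
        map_smul, pointHom_genU_basisVec, shiftOp_basisVec, smul_smul, add_zero, sub_zero]
      congr 1
      simp only [← Circle.coe_inv_eq_conj, ← Circle.coe_mul]
      refine congrArg (fun w : Circle => (w : ℂ)) ?_
      rw [eq_inv_mul_iff_mul_eq]
      ac_rfl
    · change pointHom α z (anzai α θ f (genV α)) = shiftOp 0 (diagSeq α f z) *
        pointHom α (Circle.exp θ * z) (genV α) * star (shiftOp 0 (diagSeq α f z))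
      rw [anzai_genV, map_mul]
      refine continuousLinearMap_ext_basisVec fun k => ?_
      simp only [mul_apply_eq_comp, star_shiftOp_basisVec, map_smul, pointHom_genV_basisVec,
        pointHom_circleFun_basisVec, shiftOp_basisVec, smul_smul, add_zero, sub_zero]
      congr 1
      simp only [← Circle.coe_inv_eq_conj, ← Circle.coe_mul]
      refine congrArg (fun w : Circle => (w : ℂ)) ?_
      rw [diagSeq_add_one, mul_left_comm, inv_mul_cancel, mul_one]
  exact congr($h x)

lemma coeff_anzai (α θ : ℝ) (f : C(Circle, Circle)) (i j : ℤ) (x : NCTorus.{u} α) (z : Circle) :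
    coeff i j (anzai α θ f x) z = (diagSeq α f z i : ℂ) * conj (diagSeq α f z j : ℂ) *
      coeff i j x (Circle.exp θ * z) := by
  rw [coeff, pointHom_anzai, mul_apply_eq_comp, mul_apply_eq_comp, star_shiftOp_basisVec,
    map_smul, map_smul, inner_smul_right, ← ContinuousLinearMap.adjoint_inner_left,
    ← ContinuousLinearMap.star_eq_adjoint, star_shiftOp_basisVec, inner_smul_left, add_zero,
    add_zero, Complex.conj_conj, ← mul_assoc, mul_comm (conj _), coeff]

/-! ### Irrational rotations of the circle -/

instance : Measure.IsHaarMeasure circleHaar := by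
  unfold circleHaar
  infer_instance

instance : IsProbabilityMeasure circleHaar := ⟨Measure.haarMeasure_self⟩

/-- Irrationality makes the orbit of the identity dense, and translation by an element with dense
powers is ergodic. -/
lemma ergodic_rotation {θ : ℝ} (hθ : Irrational (θ / (2 * Real.pi))) :
    Ergodic (fun z => Circle.exp θ * z) circleHaar := by
  refine ergodic_mul_left_of_denseRange_zpow ?_ circleHaar
  have : Fact (0 < 2 * Real.pi) := ⟨Real.two_pi_pos⟩
  have h : DenseRange fun k : ℤ => k • (θ : AddCircle (2 * Real.pi)) :=
    AddCircle.denseRange_zsmul_coe_iff.2 hθ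
  have h' := (AddCircle.homeomorphCircle'.surjective.denseRange).comp h
    AddCircle.homeomorphCircle'.continuous
  convert h' using 1
  funext k
  simp only [Function.comp, ← AddCircle.coe_zsmul, AddCircle.homeomorphCircle'_apply_mk,
    Circle.exp_zsmul]

/-! ### Vanishing of functions whose Fourier coefficients vanish -/

/-- Density of trigonometric polynomials, transported from `AddCircle` to `Circle`. -/
lemma continuousLinearMap_eq_zero_of_zpow {L : C(Circle, ℂ) →L[ℂ] ℂ}
    (h : ∀ (m : ℤ) (k : C(Circle, ℂ)), (∀ z, k z = ((z ^ m : Circle) : ℂ)) → L k = 0) : L = 0 := by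
  have : Fact (0 < 2 * Real.pi) := ⟨Real.two_pi_pos⟩
  let e := AddCircle.homeomorphCircle (T := 2 * Real.pi) Real.two_pi_pos.ne'
  let R : C(AddCircle (2 * Real.pi), ℂ) →L[ℂ] C(Circle, ℂ) :=
    ContinuousMap.compCLM ℂ ℂ ⟨e.symm, e.symm.continuous⟩
  have hcomp : L.comp R = 0 := by
    refine ContinuousLinearMap.ext_on (s := Set.range (@fourier (2 * Real.pi))) ?_ ?_
    · exact Submodule.dense_iff_topologicalClosure_eq_top.2 span_fourier_closure_eq_top
    · rintro _ ⟨m, rfl⟩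
      refine h m _ fun z => ?_
      change ((AddCircle.toCircle (m • e.symm z) : Circle) : ℂ) = _
      rw [AddCircle.toCircle_zsmul, ← AddCircle.homeomorphCircle_apply Real.two_pi_pos.ne',
        e.apply_symm_apply]
  ext k
  have hk : R (k.comp ⟨e, e.continuous⟩) = k := by
    ext z
    change k (e (e.symm z)) = k z
    rw [e.apply_symm_apply]
  rw [← hk]
  exact congr($hcomp (k.comp ⟨e, e.continuous⟩))

/-- Pairing with `γ` vanishes on monomials, hence on continuous functions, hence on their `L²`
closure, which contains `γ` itself. -/
lemma ae_eq_zero_of_integral_zpow {γ : Circle → ℂ} (hγ : MemLp γ 2 circleHaar)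
    (h : ∀ m : ℤ, ∫ z, ((z ^ m : Circle) : ℂ) * conj (γ z) ∂circleHaar = 0) :
    γ =ᵐ[circleHaar] 0 := by
  have hin : ∀ k : C(Circle, ℂ), inner ℂ hγ.toLp (ContinuousMap.toLp 2 circleHaar ℂ k) =
      ∫ z, k z * conj (γ z) ∂circleHaar := by
    intro k
    rw [L2.inner_def]
    refine integral_congr_ae ?_
    filter_upwards [hγ.coeFn_toLp, ContinuousMap.coeFn_toLp circleHaar (𝕜 := ℂ) (p := 2) k]
      with z h1 h2
    rw [h1, h2]
    rfl
  have hL : (innerSL ℂ hγ.toLp).comp (ContinuousMap.toLp 2 circleHaar ℂ) = 0 := by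
    refine continuousLinearMap_eq_zero_of_zpow fun m k hk => ?_
    change inner ℂ hγ.toLp (ContinuousMap.toLp 2 circleHaar ℂ k) = 0
    rw [hin]
    simpa only [hk] using h m
  have h0 : hγ.toLp = 0 := by
    have hd := ContinuousMap.toLp_denseRange (E := ℂ) circleHaar ℂ (p := 2) (by norm_num)
    have := hd.equalizer (g := fun y => inner ℂ hγ.toLp y) (h := fun _ => (0 : ℂ))
      (continuous_const.inner continuous_id) continuous_const
      (funext fun k => congr($hL k))
    exact inner_self_eq_zero.1 (congrFun this hγ.toLp)
  exact (MemLp.toLp_eq_toLp_iff hγ (MemLp.zero)).1 (h0.trans (MemLp.toLp_zero _).symm)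

/-! ### Unimodular solutions and fixed points. -/

/-- A measurable unimodular solution of the cohomological equation. -/
structure IsUnimodularSolution (α θ : ℝ) (f : C(Circle, Circle)) (n : ℤ) (γ : Circle → ℂ) :
    Prop where
  aestronglyMeasurable : AEStronglyMeasurable γ circleHaar
  norm_eq_one : ∀ᵐ z ∂circleHaar, ‖γ z‖ = 1
  solves : ∀ᵐ z ∂circleHaar, γ (Circle.exp θ * z) * (cocycle α f n z : ℂ) = γ z

lemma IsUnimodularSolution.neg {α θ : ℝ} {f : C(Circle, Circle)} {n : ℤ} {γ : Circle → ℂ}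
    (h : IsUnimodularSolution α θ f n γ) : IsUnimodularSolution α θ f n (-γ) where
  aestronglyMeasurable := h.aestronglyMeasurable.neg
  norm_eq_one := by simpa using h.norm_eq_one
  solves := by
    filter_upwards [h.solves] with z hz
    simp only [Pi.neg_apply, neg_mul, hz]

/-- Since the cocycle is unimodular, `|g|` is invariant under an ergodic rotation, hence constant.
The constant is nonzero because the zero function is continuous. -/
lemma exists_isUnimodularSolution {α θ : ℝ} (hθ : Irrational (θ / (2 * Real.pi)))
    {f : C(Circle, Circle)} {n : ℤ} {g : Lp ℂ 2 circleHaar}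
    (hg : SolvesCohomological α θ f n g) (hgc : ¬ ∃ c : C(Circle, ℂ), ⇑g =ᵐ[circleHaar] ⇑c) :
    ∃ γ : Circle → ℂ, IsUnimodularSolution α θ f n γ ∧
      ¬ ∃ c : C(Circle, ℂ), γ =ᵐ[circleHaar] ⇑c := by
  have hm : AEStronglyMeasurable g circleHaar := Lp.aestronglyMeasurable g
  obtain ⟨r, hr⟩ := (ergodic_rotation hθ).quasiErgodic.ae_eq_const_of_ae_eq_comp_ae hm.norm (by
    filter_upwards [hg] with z hz
    simp only [Function.comp]
    rw [← hz, norm_mul, Circle.norm_coe, mul_one])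
  have hr0 : (r : ℂ) ≠ 0 := by
    intro h0
    refine hgc ⟨0, ?_⟩
    filter_upwards [hr] with z hz
    rw [Function.const_apply, Complex.ofReal_eq_zero.1 h0] at hz
    exact norm_eq_zero.1 hz
  refine ⟨fun z => (r : ℂ)⁻¹ * g z, ⟨hm.const_mul _, ?_, ?_⟩, ?_⟩
  · filter_upwards [hr] with z hz
    rw [Function.const_apply] at hz
    have hr' : ‖(r : ℂ)‖ = r := by rw [← hz]; simp
    rw [norm_mul, norm_inv, hr', hz]
    exact inv_mul_cancel₀ (by exact_mod_cast hr0)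
  · filter_upwards [hg] with z hz
    rw [mul_assoc, hz]
  · rintro ⟨c, hc⟩
    refine hgc ⟨(r : ℂ) • c, ?_⟩
    filter_upwards [hc] with z hz
    rw [ContinuousMap.coe_smul, Pi.smul_apply, ← hz, smul_eq_mul, mul_inv_cancel_left₀ hr0]

lemma diagSeq_neg_coe (α : ℝ) (f : C(Circle, Circle)) (n : ℤ) (z : Circle) :
    (diagSeq α f z (-n) : ℂ) = conj (cocycle α f n z : ℂ) := by
  rw [diagSeq, neg_neg, Circle.coe_inv_eq_conj]

lemma conj_coe_mul_coe (w : Circle) : conj (w : ℂ) * (w : ℂ) = 1 := by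
  rw [← Circle.coe_inv_eq_conj, ← Circle.coe_mul, inv_mul_cancel, Circle.coe_one]

lemma coeff_star {α : ℝ} (i j : ℤ) (x : NCTorus.{u} α) (z : Circle) :
    coeff i j (star x) z = conj (coeff j i x z) := by
  rw [coeff, coeff, map_star, ContinuousLinearMap.star_eq_adjoint,
    ContinuousLinearMap.adjoint_inner_right, inner_conj_symm]

/-- The matrix coefficients of index `(0, -n)` of a fixed point vanish. -/
lemma coeff_ae_eq_zero_of_fixed {α θ : ℝ} (hθ : Irrational (θ / (2 * Real.pi)))
    {f : C(Circle, Circle)} {n : ℤ} {γ : Circle → ℂ} (h : IsUnimodularSolution α θ f n γ)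
    (hγ : ¬ ∃ c : C(Circle, ℂ), γ =ᵐ[circleHaar] ⇑c) {x : NCTorus.{u} α}
    (hx : anzai α θ f x = x) : ∀ᵐ z ∂circleHaar, coeff 0 (-n) x z = 0 := by
  -- The quotient of two solutions is rotation invariant; as `γ` is unimodular, multiplying by its
  -- conjugate is dividing by it.
  have hm : AEStronglyMeasurable (fun z => coeff 0 (-n) x z * conj (γ z)) circleHaar :=
    (continuous_coeff 0 (-n) x).aestronglyMeasurable.mul
      (Complex.continuous_conj.comp_aestronglyMeasurable h.aestronglyMeasurable)
  obtain ⟨c, hc⟩ := (ergodic_rotation hθ).quasiErgodic.ae_eq_const_of_ae_eq_comp_ae hm (by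
    filter_upwards [h.solves] with z hz
    have h1 := coeff_anzai α θ f 0 (-n) x z
    rw [hx, diagSeq_zero, diagSeq_neg_coe, Circle.coe_one, one_mul, Complex.conj_conj] at h1
    simp only [Function.comp]
    rw [h1, ← hz, map_mul]
    linear_combination (-(coeff 0 (-n) x (Circle.exp θ * z) *
      conj (γ (Circle.exp θ * z)))) * conj_coe_mul_coe (cocycle α f n z))
  have hc' : ∀ᵐ z ∂circleHaar, coeff 0 (-n) x z = c * γ z := by
    filter_upwards [hc, h.norm_eq_one] with z hz h1
    rw [Function.const_apply] at hz
    have : conj (γ z) * γ z = 1 := by rw [Complex.conj_mul', h1]; norm_num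
    rw [← hz, mul_assoc, this, mul_one]
  by_cases h0 : c = 0
  · simpa [h0] using hc'
  -- A nonzero constant would make `γ` a multiple of a continuous coefficient.
  · refine (hγ ⟨⟨fun z => c⁻¹ * coeff 0 (-n) x z,
      continuous_const.mul (continuous_coeff 0 (-n) x)⟩, ?_⟩).elim
    filter_upwards [hc'] with z hz
    simp [hz, h0]

/-! ### Two invariant states -/

/-- The vector state of `e_0 + conj γ(z) e_{-n}` in the representation at the point `z`. -/
def stateDensity {α : ℝ} (n : ℤ) (γ : Circle → ℂ) (x : NCTorus.{u} α) (z : Circle) : ℂ :=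
  2⁻¹ * (coeff 0 0 x z + coeff (-n) (-n) x z + coeff 0 (-n) x z * conj (γ z) +
    coeff (-n) 0 x z * γ z)

section

variable {α θ : ℝ} {f : C(Circle, Circle)} {n : ℤ} {γ : Circle → ℂ}

/-- Four coefficients, each at most `‖x‖`, with the factor `1/2`; the bound is not sharp and serves
only integrability and continuity. -/
lemma norm_stateDensity_le {z : Circle} (h : ‖γ z‖ = 1) (x : NCTorus.{u} α) :
    ‖stateDensity n γ x z‖ ≤ 2 * ‖x‖ := by
  have h1 : ‖coeff 0 (-n) x z * conj (γ z)‖ ≤ ‖x‖ := by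
    rw [norm_mul, RCLike.norm_conj, h, mul_one]
    exact norm_coeff_le _ _ _ _
  have h2 : ‖coeff (-n) 0 x z * γ z‖ ≤ ‖x‖ := by
    rw [norm_mul, h, mul_one]
    exact norm_coeff_le _ _ _ _
  have h3 := norm_coeff_le 0 0 x z
  have h4 := norm_coeff_le (-n) (-n) x z
  rw [stateDensity, norm_mul]
  have h5 := norm_add_le (coeff 0 0 x z + coeff (-n) (-n) x z + coeff 0 (-n) x z * conj (γ z))
    (coeff (-n) 0 x z * γ z)
  have h6 := norm_add_le (coeff 0 0 x z + coeff (-n) (-n) x z) (coeff 0 (-n) x z * conj (γ z))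
  have h7 := norm_add_le (coeff 0 0 x z) (coeff (-n) (-n) x z)
  have h8 : ‖(2⁻¹ : ℂ)‖ = 2⁻¹ := by norm_num
  rw [h8]
  linarith

lemma IsUnimodularSolution.integrable_stateDensity (h : IsUnimodularSolution α θ f n γ)
    (x : NCTorus.{u} α) : Integrable (stateDensity n γ x) circleHaar := by
  refine Integrable.of_bound (C := 2 * ‖x‖) ?_ ?_
  · refine AEStronglyMeasurable.const_mul (((?_ : AEStronglyMeasurable _ _).add ?_).add ?_) _
    · exact ((continuous_coeff 0 0 x).add (continuous_coeff (-n) (-n) x)).aestronglyMeasurable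
    · exact (continuous_coeff 0 (-n) x).aestronglyMeasurable.mul
        (Complex.continuous_conj.comp_aestronglyMeasurable h.aestronglyMeasurable)
    · exact (continuous_coeff (-n) 0 x).aestronglyMeasurable.mul h.aestronglyMeasurable
  · filter_upwards [h.norm_eq_one] with z hz using norm_stateDensity_le hz x

/-- The state of the noncommutative torus given by a unimodular solution. -/
def solutionState (h : IsUnimodularSolution α θ f n γ) : NCTorus.{u} α →ₗ[ℂ] ℂ where
  toFun x := ∫ z, stateDensity n γ x z ∂circleHaar
  map_add' x y := by
    rw [← integral_add (h.integrable_stateDensity x) (h.integrable_stateDensity y)]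
    congr 1
    funext z
    simp only [stateDensity, coeff_add]
    ring
  map_smul' c x := by
    rw [RingHom.id_apply, smul_eq_mul, ← integral_const_mul]
    congr 1
    funext z
    simp only [stateDensity, coeff_smul]
    ring

lemma solutionState_apply (h : IsUnimodularSolution α θ f n γ) (x : NCTorus.{u} α) :
    solutionState h x = ∫ z, stateDensity n γ x z ∂circleHaar := rfl

lemma norm_solutionState_le (h : IsUnimodularSolution α θ f n γ) (x : NCTorus.{u} α) :
    ‖solutionState h x‖ ≤ 2 * ‖x‖ := by
  have := norm_integral_le_of_norm_le_const (μ := circleHaar) (f := stateDensity n γ x)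
    (C := 2 * ‖x‖) (by filter_upwards [h.norm_eq_one] with z hz using norm_stateDensity_le hz x)
  simpa [solutionState_apply] using this

/-- Unimodularity enters because `stateDensity` has weight one, not `|γ z|²`, on the coefficient
`(-n, -n)`. -/
lemma stateDensity_star_mul_self {z : Circle} (h : ‖γ z‖ = 1) (x : NCTorus.{u} α) :
    stateDensity n γ (star x * x) z = ((2⁻¹ * ‖pointHom α z x
      (basisVec 0 + conj (γ z) • basisVec (-n))‖ ^ 2 : ℝ) : ℂ) := by
  have hγ : γ z * conj (γ z) = 1 := by rw [Complex.mul_conj', h]; norm_num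
  have hin : ∀ v w : EllTwo.{u}, inner ℂ v (pointHom α z (star x * x) w) =
      inner ℂ (pointHom α z x v) (pointHom α z x w) := by
    intro v w
    rw [map_mul, map_star, mul_apply_eq_comp, ContinuousLinearMap.star_eq_adjoint,
      ContinuousLinearMap.adjoint_inner_right]
  push_cast
  rw [← Complex.coe_algebraMap, ← inner_self_eq_norm_sq_to_K (𝕜 := ℂ)]
  simp only [stateDensity, coeff, hin, map_add, map_smul, inner_add_left, inner_add_right,
    inner_smul_left, inner_smul_right, Complex.conj_conj]
  linear_combination (-2⁻¹ * inner ℂ (pointHom α z x (basisVec (-n)))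
    (pointHom α z x (basisVec (-n)))) * hγ

lemma coeff_one (i j : ℤ) (z : Circle) :
    coeff i j (1 : NCTorus.{u} α) z = if i = j then 1 else 0 := by
  rw [coeff, map_one, one_apply_eq_self, inner_basisVec, basisVec_apply]

lemma isState_solutionState (hn : n ≠ 0) (h : IsUnimodularSolution α θ f n γ) :
    IsState (solutionState.{u} h) where
  map_one := by
    rw [solutionState_apply]
    -- `n ≠ 0` makes `e_0` and `e_{-n}` orthogonal, so only the diagonal terms survive.
    have : stateDensity n γ (1 : NCTorus.{u} α) = fun _ => 1 := by
      funext z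
      simp only [stateDensity, coeff_one, if_true, zero_eq_neg, neg_eq_zero, hn, if_false]
      norm_num
    simp [this]
  nonneg x := by
    have : solutionState h (star x * x) = ((∫ z, 2⁻¹ * ‖pointHom α z x
        (basisVec 0 + conj (γ z) • basisVec (-n))‖ ^ 2 ∂circleHaar : ℝ) : ℂ) := by
      rw [solutionState_apply, ← integral_complex_ofReal]
      refine integral_congr_ae ?_
      filter_upwards [h.norm_eq_one] with z hz using stateDensity_star_mul_self hz x
    rw [this]
    exact ⟨integral_nonneg fun z => by positivity, Complex.ofReal_im _⟩

/-- The cohomological equation absorbs the cocycle factors in the off-diagonal terms, so the density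
of `Φ x` at `z` is that of `x` at the rotated point; Haar measure is invariant. -/
lemma solutionState_anzai (h : IsUnimodularSolution α θ f n γ) (x : NCTorus.{u} α) :
    solutionState h (anzai α θ f x) = solutionState h x := by
  rw [solutionState_apply, solutionState_apply,
    ← integral_mul_left_eq_self (stateDensity n γ x) (Circle.exp θ)]
  refine integral_congr_ae ?_
  filter_upwards [h.solves] with z hz
  have hf := conj_coe_mul_coe (cocycle α f n z)
  have hz' := congrArg conj hz
  rw [map_mul] at hz'
  simp only [stateDensity, coeff_anzai, diagSeq_zero, diagSeq_neg_coe, Circle.coe_one,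
    Complex.conj_conj, map_one]
  rw [← hz', ← hz]
  linear_combination (2⁻¹ * (coeff (-n) (-n) x (Circle.exp θ * z) +
    coeff 0 (-n) x (Circle.exp θ * z) * conj (γ (Circle.exp θ * z)) +
    coeff (-n) 0 x (Circle.exp θ * z) * γ (Circle.exp θ * z))) * hf

lemma solutionState_neg_eq_of_fixed (hθ : Irrational (θ / (2 * Real.pi)))
    (h : IsUnimodularSolution α θ f n γ)
    (hγ : ¬ ∃ c : C(Circle, ℂ), γ =ᵐ[circleHaar] ⇑c) {x : NCTorus.{u} α}
    (hx : anzai α θ f x = x) : solutionState h.neg x = solutionState h x := by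
  rw [solutionState_apply, solutionState_apply]
  refine integral_congr_ae ?_
  -- The coefficient `(-n, 0)` of `x` is the conjugate of the coefficient `(0, -n)` of `star x`,
  -- which is also fixed.
  have hx' : anzai α θ f (star x) = star x := by rw [map_star, hx]
  filter_upwards [coeff_ae_eq_zero_of_fixed hθ h hγ hx,
    coeff_ae_eq_zero_of_fixed hθ h hγ hx'] with z h1 h2
  rw [coeff_star, map_eq_zero] at h2
  simp only [stateDensity, h1, h2, zero_mul]

/-- The witness is the power `V^n`, built from `V` and `star V` according to the sign of `n`. -/
lemma exists_pointHom_eq_shift (α : ℝ) (n : ℤ) : ∃ v : NCTorus.{u} α, ∀ (z : Circle) (k : ℤ),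
    pointHom α z v (basisVec k) = basisVec (k + n) := by
  have hs : ∀ (z : Circle) (k : ℤ),
      pointHom α z (star (genV.{u} α)) (basisVec k) = basisVec (k - 1) := by
    intro z k
    rw [map_star, pointHom_genV, star_shiftOp_basisVec]
    simp [sub_eq_add_neg]
  induction n using Int.induction_on with
  | zero => exact ⟨1, fun z k => by rw [map_one, one_apply_eq_self, add_zero]⟩
  | succ n ih =>
    obtain ⟨v, hv⟩ := ih
    refine ⟨genV α * v, fun z k => ?_⟩
    rw [map_mul, mul_apply_eq_comp, hv, pointHom_genV_basisVec, add_assoc]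
  | pred n ih =>
    obtain ⟨v, hv⟩ := ih
    refine ⟨star (genV α) * v, fun z k => ?_⟩
    rw [map_mul, mul_apply_eq_comp, hv, hs, add_sub_assoc]

/-- The witness is `U^m V^n`; on these elements the difference of the two states reads off the
Fourier coefficients of `conj γ`. -/
lemma exists_coeff_eq_zpow (α : ℝ) {n : ℤ} (hn : n ≠ 0) (m : ℤ) :
    ∃ a : NCTorus.{u} α, ∀ z : Circle, coeff 0 (-n) a z = ((z ^ m : Circle) : ℂ) ∧
      coeff (-n) 0 a z = 0 := by
  obtain ⟨v, hv⟩ := exists_pointHom_eq_shift.{u} α n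
  refine ⟨circleFun ⟨fun z => z ^ m, continuous_zpow m⟩ (genU α) * v, fun z => ⟨?_, ?_⟩⟩
  · rw [coeff, map_mul, mul_apply_eq_comp, hv, neg_add_cancel, pointHom_circleFun_basisVec,
      inner_smul_right, inner_basisVec, basisVec_apply, rotSeq_zero]
    simp
  · have : -n ≠ n := by omega
    rw [coeff, map_mul, mul_apply_eq_comp, hv, pointHom_circleFun_basisVec,
      inner_smul_right, inner_basisVec, basisVec_apply]
    simp [this]

lemma exists_solutionState_neg_ne (hn : n ≠ 0) (h : IsUnimodularSolution α θ f n γ) :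
    ∃ a : NCTorus.{u} α, solutionState h.neg a ≠ solutionState h a := by
  by_contra! H
  have hγ0 : γ =ᵐ[circleHaar] 0 := by
    refine ae_eq_zero_of_integral_zpow (MemLp.of_bound h.aestronglyMeasurable 1
      (h.norm_eq_one.mono fun z hz => hz.le)) fun m => ?_
    obtain ⟨a, ha⟩ := exists_coeff_eq_zpow.{u} α hn m
    have := sub_eq_zero.2 (H a).symm
    rw [solutionState_apply, solutionState_apply, ← integral_sub (h.integrable_stateDensity a)
      (h.neg.integrable_stateDensity a)] at this
    rw [← this]
    congr 1
    -- The diagonal terms cancel, and the doubled off-diagonal term cancels the factor `1/2`.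
    funext z
    simp only [stateDensity, (ha z).1, (ha z).2, Pi.neg_apply, map_neg]
    ring
  have : ∀ᵐ z ∂circleHaar, False := by
    filter_upwards [hγ0, h.norm_eq_one] with z h0 h1
    rw [h0] at h1
    simp at h1
  simp [IsProbabilityMeasure.ne_zero] at this

end

end NCAnzai
end

/-! ### Cesàro means and the main theorem. -/

namespace NCAnzai

open Filter Topology in
/-- If an invariant bounded functional vanishes on the fixed points, but not at `a`, then the
Cesàro means of `a` do not converge weakly. -/
lemma not_tendsto_cesaroMean {A : Type*} [NormedAddCommGroup A] [NormedSpace ℂ A]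
    {Φ : A →L[ℂ] A} (hΦ : ∀ x, ‖Φ x‖ ≤ ‖x‖) {L : A →L[ℂ] ℂ} (hL : ∀ x, L (Φ x) = L x)
    (hfix : ∀ x, Φ x = x → L x = 0) {a : A} (ha : L a ≠ 0) :
    ¬ ∃ b : A, Tendsto (fun N => toWeakSpace ℂ A (cesaroMean Φ a N)) atTop
      (𝓝 (toWeakSpace ℂ A b)) := by
  rintro ⟨b, hb⟩
  have hweak : ∀ l : A →L[ℂ] ℂ, Tendsto (fun N => l (cesaroMean Φ a N)) atTop (𝓝 (l b)) :=
    fun l => ((WeakBilin.eval_continuous (topDualPairing ℂ A).flip l).tendsto _).comp hb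
  have hnorm : ∀ k : ℕ, ‖Φ^[k] a‖ ≤ ‖a‖ := by
    intro k
    induction k with
    | zero => rfl
    | succ k ih =>
      rw [Function.iterate_succ_apply']
      exact (hΦ _).trans ih
  -- The sum telescopes, so the means are asymptotically fixed in norm.
  have hdiff : ∀ N, Φ (cesaroMean Φ a N) - cesaroMean Φ a N = (N : ℂ)⁻¹ • (Φ^[N] a - a) := by
    intro N
    rw [cesaroMean, map_smul, map_sum, ← smul_sub, ← Finset.sum_sub_distrib]
    simp only [← Function.iterate_succ_apply' Φ]
    rw [Finset.sum_range_sub fun k => Φ^[k] a]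
    rfl
  have hdiff0 : Tendsto (fun N => Φ (cesaroMean Φ a N) - cesaroMean Φ a N) atTop (𝓝 0) := by
    have h0 : Tendsto (fun N : ℕ => (N : ℝ)⁻¹ * (2 * ‖a‖)) atTop (𝓝 0) := by
      simpa using tendsto_inv_atTop_nhds_zero_nat.mul_const (2 * ‖a‖)
    refine squeeze_zero_norm (fun N => ?_) h0
    rw [hdiff, norm_smul, norm_inv, Complex.norm_natCast]
    gcongr
    linarith [norm_sub_le (Φ^[N] a) a, hnorm N]
  -- Functionals separate points, and both `l` and `l ∘ Φ` can be tested against the weak limit.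
  have hbfix : Φ b = b := by
    refine (SeparatingDual.eq_iff_forall_dual_eq (R := ℂ)).2 fun l => ?_
    have h1 := (hweak (l.comp Φ)).sub (hweak l)
    have h2 := (l.continuous.tendsto 0).comp hdiff0
    rw [map_zero] at h2
    refine sub_eq_zero.1 (tendsto_nhds_unique h1 (h2.congr fun N => ?_))
    simp
  have hLk : ∀ k : ℕ, L (Φ^[k] a) = L a := by
    intro k
    induction k with
    | zero => rfl
    | succ k ih => rw [Function.iterate_succ_apply', hL, ih]
  -- `N = 0` is excluded because that mean is `0` by the convention for the inverse.
  have hLN : ∀ᶠ N : ℕ in atTop, L (cesaroMean Φ a N) = L a := by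
    filter_upwards [eventually_ne_atTop 0] with N hN
    have : (N : ℂ) ≠ 0 := Nat.cast_ne_zero.2 hN
    simp [cesaroMean, hLk, this]
  refine ha ((tendsto_nhds_unique (hweak L) ?_).symm.trans (hfix b hbfix))
  exact tendsto_const_nhds.congr' (hLN.mono fun N h => h.symm)

end NCAnzai

theorem mainTheorem7 (α θ : ℝ) (hθ : Irrational (θ / (2 * Real.pi))) (f : C(Circle, Circle))
    (n : ℤ) (hn : n ≠ 0) (g : Lp ℂ 2 NCAnzai.circleHaar)
    (hg : NCAnzai.SolvesCohomological α θ f n g)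
    (hgc : ¬ ∃ c : C(Circle, ℂ), ⇑g =ᵐ[NCAnzai.circleHaar] ⇑c) :
    (∃ a : NCAnzai.NCTorus.{u} α, ¬ ∃ b : NCAnzai.NCTorus.{u} α,
      Filter.Tendsto
        (fun N : ℕ => toWeakSpace ℂ (NCAnzai.NCTorus.{u} α)
          (NCAnzai.cesaroMean (NCAnzai.anzai α θ f) a N))
        Filter.atTop (nhds (toWeakSpace ℂ (NCAnzai.NCTorus.{u} α) b))) ∧
    (¬ ∀ a : NCAnzai.NCTorus.{u} α, ∃ b : NCAnzai.NCTorus.{u} α,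
      Filter.Tendsto (NCAnzai.cesaroMean (NCAnzai.anzai α θ f) a) Filter.atTop (nhds b)) ∧
    ¬ NCAnzai.UniquelyErgodicRelFixed (NCAnzai.anzai.{u} α θ f) := by
  obtain ⟨γ, h, hγ⟩ := NCAnzai.exists_isUnimodularSolution hθ hg hgc
  obtain ⟨a, ha⟩ := NCAnzai.exists_solutionState_neg_ne.{u} hn h
  have hnorm : ∀ x, ‖NCAnzai.anzai.{u} α θ f x‖ ≤ ‖x‖ := fun x =>
    NonUnitalStarAlgHom.norm_apply_le (NCAnzai.anzai.{u} α θ f) x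
  have hweak : ¬ ∃ b : NCAnzai.NCTorus.{u} α,
      Filter.Tendsto
        (fun N : ℕ => toWeakSpace ℂ (NCAnzai.NCTorus.{u} α)
          (NCAnzai.cesaroMean (NCAnzai.anzai α θ f) a N))
        Filter.atTop (nhds (toWeakSpace ℂ (NCAnzai.NCTorus.{u} α) b)) := by
    let Φ : NCAnzai.NCTorus.{u} α →ₗ[ℂ] NCAnzai.NCTorus.{u} α :=
      { toFun := NCAnzai.anzai α θ f
        map_add' := map_add _
        map_smul' := map_smul _ }
    refine NCAnzai.not_tendsto_cesaroMean
      (Φ := Φ.mkContinuous 1 fun x => by rw [one_mul]; exact hnorm x) hnorm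
      -- The difference of the two invariant states.
      (L := (NCAnzai.solutionState h.neg).mkContinuous 2 (NCAnzai.norm_solutionState_le h.neg) -
        (NCAnzai.solutionState h).mkContinuous 2 (NCAnzai.norm_solutionState_le h))
      (fun x => ?_) (fun x hx => ?_) ?_
    · exact congrArg₂ (· - ·) (NCAnzai.solutionState_anzai h.neg x)
        (NCAnzai.solutionState_anzai h x)
    · exact sub_eq_zero.2 (NCAnzai.solutionState_neg_eq_of_fixed hθ h hγ hx)
    · exact sub_ne_zero.2 ha
  refine ⟨⟨a, hweak⟩, fun H => ?_, fun H => ?_⟩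
  · obtain ⟨b, hb⟩ := H a
    exact hweak ⟨b, ((toWeakSpaceCLM ℂ (NCAnzai.NCTorus.{u} α)).continuous.tendsto b).comp hb⟩
  · have hs := NCAnzai.isState_solutionState.{u} hn h
    -- The state of `γ`, restricted to the fixed points, is extended by the states of both `γ` and
    -- `-γ`.
    obtain ⟨φ, -, hφ⟩ := H ((NCAnzai.solutionState h).comp
      (NCAnzai.fixedSubalgebra (NCAnzai.anzai.{u} α θ f)).subtype.toAlgHom.toLinearMap)
      ⟨hs.map_one, fun b => hs.nonneg b⟩
    have h1 := hφ (NCAnzai.solutionState h)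
      ⟨hs, NCAnzai.solutionState_anzai h, fun b => rfl⟩
    have h2 := hφ (NCAnzai.solutionState h.neg)
      ⟨NCAnzai.isState_solutionState hn h.neg, NCAnzai.solutionState_anzai h.neg,
        fun b => NCAnzai.solutionState_neg_eq_of_fixed hθ h hγ b.2⟩
    exact ha (by rw [h1, h2])
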